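/- **Setting.** Let $q\ge 2$, let $\|\cdot\|$ be an arbitrary norm on $\mathbb{R}^q$ with dual norm $\|\cdot\|_*$, and let $\mathbb{B}_\epsilon(0)$ be the closed $\epsilon$-ball of $\|\cdot\|$. Let $C\subsetneq\mathbb{R}^q$ be a closed convex cone that is solid ($\operatorname{int} C\ne\emptyset$), pointed ($C\cap -C=\{0\}$) and polyhedral, and write $y\le_C y'$ if $y'-y\in C$. Let $X\subseteq\mathbb{R}^n$ be convex, let $\Gamma\colon X\to\mathbb{R}^q$ be continuous and $C$-convex, i.e. $\Gamma(tx_1+(1-t)x_2)\le_C t\Gamma(x_1)+(1-t)\Gamma(x_2)$ for $x_1,x_2\in X$, $t\in[0,1]$, and let $\mathcal{X}\subseteq X$ be compact and convex with nonempty interior. Let $\mathcal{P}=\Gamma(\mathcal{X})+C$ be the upper image of the problem of minimizing $\Gamma$ over $\mathcal{X}$ with respect to $\le_C$. A point $\bar x\in\mathcal{X}$ is a *weak minimizer* if $(\{\Gamma(\bar x)\}-\operatorname{int} C)\cap\Gamma(\mathcal{X})=\emptyset$. A *finite weak $\epsilon$-solution* is a nonempty finite set $\bar{\mathcal{X}}\subseteq\mathcal{X}$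 of weak minimizers with $\operatorname{conv}\Gamma(\bar{\mathcal{X}})+C+\mathbb{B}_\epsilon(0)\supseteq\mathcal{P}$. Let $C^+=\{w : w^{\mathsf T}y\ge 0\ \forall y\in C\}$, let $w^1,\dots,w^J$ with $\|w^j\|_*=1$ be vectors whose nonnegative linear combinations are exactly the elements of $C^+$, put $\bar w=\sum_j w^j/\|\sum_j w^j\|_*$, and for $\gamma\in\mathbb{R}$ put $S(\gamma)=\{y : \bar w^{\mathsf T}y\le\gamma\}$. For $v\in\mathbb{R}^q$ let (P$(v)$) be the problem $$\text{minimize } \|z\|\quad\text{s.t. } \Gamma(x)\le_C v+z,\ \bar w^{\mathsf T}(v+z)\le\gamma,\ x\in\mathcal{X},\ z\in\mathbb{R}^q,$$ and (D$(v)$) its Lagrange dual: maximize over $w\in C^+$, $\lambda\ge 0$ $$\phi(w,\lambda)=\inf_{x\in\mathcal{X},\,z\in\mathbb{R}^q}\bigl(\|z\|+w^{\mathsf T}(\Gamma(x)-z-v)+\lambda(\bar w^{\mathsf T}(v+z)-\gamma)\bigr)\in[-\infty,\infty).$$ Write $\operatorname{ext}$ for the set of extreme points and $\delta^H$ for the Hausdorff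 distance. **Algorithm 2** (input: the problem, $w^1,\dots,w^J$, and $\epsilon>0$). 1. For each $j$ compute a minimizer $x^j$ of $(w^j)^{\mathsf T}\Gamma$ over $\mathcal{X}$. Put $\mathcal{P}_0^{\rm out}=\bigcap_j\{y : (w^j)^{\mathsf T}y\ge (w^j)^{\mathsf T}\Gamma(x^j)\}$. Choose $\beta\ge\sup_{x\in\mathcal{X}}\bar w^{\mathsf T}\Gamma(x)$ and $\gamma>\sup_{x\in\mathcal{X}}\bar w^{\mathsf T}\Gamma(x)+\max_{v\in\operatorname{ext}\mathcal{P}_0^{\rm out}}(\bar w^{\mathsf T}v-\beta)^+ +\delta^H(\mathcal{P}_0^{\rm out},\mathcal{P})$. Put $k=0$, $\bar{\mathcal{P}}_0^{\rm out}=\mathcal{P}_0^{\rm out}\cap S(\gamma)$, $\bar{\mathcal{X}}_0=\{x^1,\dots,x^J\}$, $\mathcal{V}^{\rm known}=\mathcal{V}^{\rm known2}=\emptyset$. 2. For each $v\in\operatorname{ext}\bar{\mathcal{P}}_k^{\rm out}\setminus\mathcal{V}^{\rm known}$, in any order: if $v\notin\mathcal{V}^{\rm known2}$, compute and store optimal solutions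 $(x^v,z^v)$ of (P$(v)$) and $(w^v,\lambda^v)$ of (D$(v)$); then, if $\|z^v\|\le\epsilon$, add $x^v$ to $\bar{\mathcal{X}}_k$ and $v$ to $\mathcal{V}^{\rm known}$, and otherwise add $v$ to $\mathcal{V}^{\rm known2}$. 3. Choose $v^k\in\operatorname{argmax}\{\|z^v\| : v\in\operatorname{ext}\bar{\mathcal{P}}_k^{\rm out}\}$. If $\|z^{v^k}\|>\epsilon$, put $\tilde w=w^{v^k}-\lambda^{v^k}\bar w$, $\bar{\mathcal{P}}_{k+1}^{\rm out}=\bar{\mathcal{P}}_k^{\rm out}\cap\{y : \tilde w^{\mathsf T}y\ge\tilde w^{\mathsf T}(v^k+z^{v^k})\}$, $\bar{\mathcal{X}}_{k+1}=\bar{\mathcal{X}}_k$, increase $k$ by one and go to 2. Otherwise terminate and return $\bar{\mathcal{X}}_k$ and $\bar{\mathcal{P}}_k^{\rm out}$. **Theorem.** Under these assumptions Algorithm 2 works correctly, whatever choices it makes. Each of its steps can be carried out: the required optimal solutions and an admissible $\gamma$ exist, the sets $\operatorname{ext}\bar{\mathcal{P}}_k^{\rm out}$ can be enumerated by finite lists,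 and the argmax is attained. If the algorithm terminates, then the returned set $\bar{\mathcal{X}}_k$ is a finite weak $\epsilon$-solution, that is, it is a nonempty finite set of weak minimizers and $$\operatorname{conv}\Gamma(\bar{\mathcal{X}}_k)+C+\mathbb{B}_\epsilon(0)\supseteq\mathcal{P},$$ and the returned set $\bar{\mathcal{P}}_k^{\rm out}$ is an outer approximation: $\bar{\mathcal{P}}_k^{\rm out}\supseteq\mathcal{P}\cap S(\gamma)$. -/

import Mathlib

open scoped Pointwise

/-- A convex vector optimization problem: minimize `Γ x` with respect to `≤_C` over `x ∈ feas`.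
The objective space `Y` (a finite dimensional real normed space) is `ℝ^q` with an arbitrary norm.
The values of `Γ` outside its domain `dom` play no role. -/
structure CVOP (n : ℕ) (Y : Type*) [NormedAddCommGroup Y] [NormedSpace ℝ Y] where
  /-- the ordering cone (a `ProperCone` is a nonempty closed convex cone) -/
  C : ProperCone ℝ Y
  C_ne_univ : (C : Set Y) ≠ Set.univ
  C_solid : (interior (C : Set Y)).Nonempty
  C_pointed : (C : Set Y) ∩ -(C : Set Y) = {0}
  /-- the domain of the objective function -/
  dom : Set (EuclideanSpace ℝ (Fin n))
  dom_convex : Convex ℝ dom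
  /-- the objective function -/
  Γ : EuclideanSpace ℝ (Fin n) → Y
  Γ_continuous : ContinuousOn Γ dom
  Γ_convex : ∀ x₁ ∈ dom, ∀ x₂ ∈ dom, ∀ t ∈ Set.Icc (0 : ℝ) 1,
    (t • Γ x₁ + (1 - t) • Γ x₂) - Γ (t • x₁ + (1 - t) • x₂) ∈ C
  /-- the feasible set -/
  feas : Set (EuclideanSpace ℝ (Fin n))
  feas_subset : feas ⊆ dom
  feas_compact : IsCompact feas
  feas_convex : Convex ℝ feas
  feas_interior : (interior feas).Nonempty

namespace CVOP

variable {n : ℕ} {Y : Type*} [NormedAddCommGroup Y] [NormedSpace ℝ Y]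

/-- The ordering cone is polyhedral: it is an intersection of finitely many halfspaces whose
boundaries pass through the origin. -/
def PolyhedralCone (P : CVOP n Y) : Prop :=
  ∃ F : Set (StrongDual ℝ Y), F.Finite ∧ (P.C : Set Y) = {y | ∀ f ∈ F, 0 ≤ f y}

/-- The dual cone `C⁺`. The vector `w` is identified with the functional `y ↦ wᵀ y`, so that the
dual norm of `w` is the operator norm. -/
def dualCone (P : CVOP n Y) : Set (StrongDual ℝ Y) := {w | ∀ y ∈ P.C, 0 ≤ w y}

/-- `w¹, …, wᴶ` generate the dual cone (which is their convex conic hull) and have dual norm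
one. -/
def IsDualGenerators (P : CVOP n Y) {J : ℕ} (w : Fin J → StrongDual ℝ Y) : Prop :=
  P.dualCone = {u | ∃ c : Fin J → ℝ, (∀ j, 0 ≤ c j) ∧ u = ∑ j, c j • w j} ∧ ∀ j, ‖w j‖ = 1

/-- The upper image `Γ(𝒳) + C`. -/
def upperImage (P : CVOP n Y) : Set Y := P.Γ '' P.feas + (P.C : Set Y)

/-- The weakly `C`-minimal elements of a set `A`. -/
def wMin (P : CVOP n Y) (A : Set Y) : Set Y :=
  {y | y ∈ A ∧ ({y} - interior (P.C : Set Y)) ∩ A = ∅}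

def IsWeakMinimizer (P : CVOP n Y) (x : EuclideanSpace ℝ (Fin n)) : Prop :=
  x ∈ P.feas ∧ P.Γ x ∈ P.wMin (P.Γ '' P.feas)

/-- Finite weak `ε`-solutions. -/
def IsFiniteWeakSolution (P : CVOP n Y) (ε : ℝ) (Xbar : Set (EuclideanSpace ℝ (Fin n))) : Prop :=
  Xbar.Nonempty ∧ Xbar.Finite ∧ (∀ x ∈ Xbar, P.IsWeakMinimizer x) ∧
    P.upperImage ⊆ (convexHull ℝ (P.Γ '' Xbar) + (P.C : Set Y)) + Metric.closedBall (0 : Y) ε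

/-- `x` is an optimal solution of the weighted sum scalarization with weight `w`. -/
def IsWSOptimal (P : CVOP n Y) (w : StrongDual ℝ Y) (x : EuclideanSpace ℝ (Fin n)) : Prop :=
  x ∈ P.feas ∧ ∀ x' ∈ P.feas, w (P.Γ x) ≤ w (P.Γ x')

/-- The halfspace `S(γ)`. -/
def halfspaceS (wbar : StrongDual ℝ Y) (γ : ℝ) : Set Y := {y | wbar y ≤ γ}

/-- Feasibility of `(x, z)` for the modified norm-minimizing scalarization (P(v)). -/
def PrimalFeasible (P : CVOP n Y) (wbar : StrongDual ℝ Y) (γ : ℝ) (v : Y)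
    (x : EuclideanSpace ℝ (Fin n)) (z : Y) : Prop :=
  x ∈ P.feas ∧ (v + z) - P.Γ x ∈ P.C ∧ wbar (v + z) ≤ γ

/-- `(x, z)` is an optimal solution of (P(v)). -/
def IsPrimalOptimal (P : CVOP n Y) (wbar : StrongDual ℝ Y) (γ : ℝ) (v : Y)
    (x : EuclideanSpace ℝ (Fin n)) (z : Y) : Prop :=
  P.PrimalFeasible wbar γ v x z ∧
    ∀ x' z', P.PrimalFeasible wbar γ v x' z' → ‖z‖ ≤ ‖z'‖

/-- The objective function `φ` of the Lagrange dual (D(v)) of (P(v)); it may take the value `-∞`. -/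
noncomputable def dualObjective (P : CVOP n Y) (wbar : StrongDual ℝ Y) (γ : ℝ) (v : Y)
    (w : StrongDual ℝ Y) (lam : ℝ) : EReal :=
  ⨅ x ∈ P.feas, ⨅ z : Y, ((‖z‖ + w (P.Γ x - z - v) + lam * (wbar (v + z) - γ) : ℝ) : EReal)

/-- `(w, lam)` is an optimal solution of (D(v)). -/
def IsDualOptimal (P : CVOP n Y) (wbar : StrongDual ℝ Y) (γ : ℝ) (v : Y)
    (w : StrongDual ℝ Y) (lam : ℝ) : Prop :=
  (w ∈ P.dualCone ∧ 0 ≤ lam) ∧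
    ∀ w' ∈ P.dualCone, ∀ lam' : ℝ, 0 ≤ lam' →
      P.dualObjective wbar γ v w' lam' ≤ P.dualObjective wbar γ v w lam

/-- The normalized sum `w̄` of the generating vectors. -/
noncomputable def wbar {J : ℕ} (w : Fin J → StrongDual ℝ Y) : StrongDual ℝ Y :=
  ‖∑ j, w j‖⁻¹ • ∑ j, w j

/-- The polyhedron `P₀ᵒᵘᵗ` given by the solutions `x¹, …, xᴶ` of the weighted sum problems. -/
def outerZero (P : CVOP n Y) {J : ℕ} (w : Fin J → StrongDual ℝ Y)
    (x : Fin J → EuclideanSpace ℝ (Fin n)) : Set Y :=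
  {y | ∀ j, w j (P.Γ (x j)) ≤ w j y}

/-- The condition on the parameter `γ`. All suprema are over nonempty bounded sets (the second one
over the finite set of vertices of `P₀ᵒᵘᵗ`), and the Hausdorff distance is finite. -/
def IsAdmissibleGamma (P : CVOP n Y) {J : ℕ} (w : Fin J → StrongDual ℝ Y)
    (x : Fin J → EuclideanSpace ℝ (Fin n)) (γ : ℝ) : Prop :=
  ∃ β : ℝ, sSup ((fun x' => wbar w (P.Γ x')) '' P.feas) ≤ β ∧
    sSup ((fun x' => wbar w (P.Γ x')) '' P.feas)
      + sSup ((fun v => max (wbar w v - β) 0) '' Set.extremePoints ℝ (P.outerZero w x))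
      + Metric.hausdorffDist (P.outerZero w x) P.upperImage < γ

/-- A stored pair of solutions `(x, z)` of (P(v)) and `(w, lam)` of (D(v)). -/
structure Sol (n : ℕ) (Y : Type*) [NormedAddCommGroup Y] [NormedSpace ℝ Y] where
  x : EuclideanSpace ℝ (Fin n)
  z : Y
  w : StrongDual ℝ Y
  lam : ℝ

/-- The variables of the algorithm. -/
structure Memory (n : ℕ) (Y : Type*) [NormedAddCommGroup Y] [NormedSpace ℝ Y] where
  /-- the parameter `γ`, which is never changed after the initialization -/
  γ : ℝ
  /-- the iteration counter -/
  k : ℕ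
  /-- the current outer approximation -/
  Pout : Set Y
  /-- the current set of weak minimizers -/
  Xbar : Set (EuclideanSpace ℝ (Fin n))
  known : Set Y
  known2 : Set Y
  /-- the table of the solutions computed so far; `sol v` is arbitrary until `v` has been
  treated -/
  sol : Y → Sol n Y

/-- The control states of the algorithm. -/
inductive Config (n : ℕ) (Y : Type*) [NormedAddCommGroup Y] [NormedSpace ℝ Y] where
  /-- before the initialization -/
  | start : Config n Y
  /-- at the beginning of the body of the repeat loop -/
  | loopHead (m : Memory n Y) : Config n Y
  /-- in the for loop, with the list of the vertices that have not been visited yet -/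
  | forLoop (m : Memory n Y) (todo : List Y) : Config n Y
  /-- the algorithm has terminated; it returns `m.Xbar` and `m.Pout` -/
  | halted (m : Memory n Y) : Config n Y

/-- Storing a computed solution for `v`. -/
noncomputable def Memory.store (m : Memory n Y) (v : Y) (s : Sol n Y) : Memory n Y :=
  open Classical in { m with sol := Function.update m.sol v s }

/-- The second conditional in the body of the for loop. -/
noncomputable def Memory.record (m : Memory n Y) (ε : ℝ) (v : Y) : Memory n Y :=
  open Classical in
  if ‖(m.sol v).z‖ ≤ ε then
    { m with Xbar := m.Xbar ∪ {(m.sol v).x}, known := m.known ∪ {v} }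
  else { m with known2 := m.known2 ∪ {v} }

/-- `v` is a vertex of the current outer approximation with largest `‖z^v‖`. -/
def Memory.IsFarthest (m : Memory n Y) (v : Y) : Prop :=
  v ∈ Set.extremePoints ℝ m.Pout ∧
    ∀ u ∈ Set.extremePoints ℝ m.Pout, ‖(m.sol u).z‖ ≤ ‖(m.sol v).z‖

/-- The halfspace `{y | w̃ᵀ y ≥ w̃ᵀ (v + z)}`, where `w̃ = w - lam • w̄`. -/
def Sol.cutHalfspace (s : Sol n Y) (wbar : StrongDual ℝ Y) (v : Y) : Set Y :=
  {y | (s.w - s.lam • wbar) (v + s.z) ≤ (s.w - s.lam • wbar) y}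

/-- One step of the algorithm with tolerance `ε` and generating vectors `w` of the dual cone.
All choices that the algorithm leaves open (solutions of the scalarizations, `γ`, the order in
which vertices are visited, the farthest vertex) are arbitrary. -/
inductive Step (P : CVOP n Y) {J : ℕ} (w : Fin J → StrongDual ℝ Y) (ε : ℝ) :
    Config n Y → Config n Y → Prop
  /-- initialization -/
  | init (x : Fin J → EuclideanSpace ℝ (Fin n)) (γ : ℝ) (sol₀ : Y → Sol n Y)
      (hx : ∀ j, P.IsWSOptimal (w j) (x j)) (hγ : P.IsAdmissibleGamma w x γ) :
      Step P w ε Config.start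
        (Config.loopHead
          { γ := γ, k := 0, Pout := P.outerZero w x ∩ halfspaceS (wbar w) γ,
            Xbar := Set.range x, known := ∅, known2 := ∅, sol := sol₀ })
  /-- computation of the vertices and entry into the for loop -/
  | enter (m : Memory n Y) (l : List Y) (hl : l.Nodup)
      (hmem : ∀ v, v ∈ l ↔ v ∈ Set.extremePoints ℝ m.Pout \ m.known) :
      Step P w ε (Config.loopHead m) (Config.forLoop m l)
  /-- body of the for loop at a vertex that has not been treated before -/
  | solve (m : Memory n Y) (v : Y) (l : List Y) (s : Sol n Y) (hv : v ∉ m.known2)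
      (hprimal : P.IsPrimalOptimal (wbar w) m.γ v s.x s.z)
      (hdual : P.IsDualOptimal (wbar w) m.γ v s.w s.lam) :
      Step P w ε (Config.forLoop m (v :: l)) (Config.forLoop ((m.store v s).record ε v) l)
  /-- body of the for loop at a vertex whose solutions have been computed before -/
  | reuse (m : Memory n Y) (v : Y) (l : List Y) (hv : v ∈ m.known2) :
      Step P w ε (Config.forLoop m (v :: l)) (Config.forLoop (m.record ε v) l)
  /-- after the for loop: the outer approximation is refined -/
  | cut (m : Memory n Y) (v : Y) (hv : m.IsFarthest v) (hz : ε < ‖(m.sol v).z‖) :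
      Step P w ε (Config.forLoop m [])
        (Config.loopHead
          { m with k := m.k + 1, Pout := m.Pout ∩ (m.sol v).cutHalfspace (wbar w) v })
  /-- after the for loop: the algorithm terminates -/
  | halt (m : Memory n Y) (v : Y) (hv : m.IsFarthest v) (hz : ‖(m.sol v).z‖ ≤ ε) :
      Step P w ε (Config.forLoop m []) (Config.halted m)

/-- `c` occurs in some run of the algorithm. -/
def Reachable (P : CVOP n Y) {J : ℕ} (w : Fin J → StrongDual ℝ Y) (ε : ℝ)
    (c : Config n Y) : Prop :=
  Relation.ReflTransGen (P.Step w ε) Config.start c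

end CVOP

/-! The proof is an invariant argument over all runs. `Memory.Valid` records that the current outer
approximation is a compact polyhedron lying between the truncated upper image and the halfspace
`S(γ)`, that all collected points are weak minimizers, and that every vertex marked `known`
(`known2`) carries optimal solutions with `‖z‖ ≤ ε` (`‖z‖ > ε`). When the for loop ends, every
vertex has one of the two marks; halting excludes `known2`, so each vertex lies in `Γ x + C + 𝔹_ε`
for a collected `x`. The vertices span the compact polyhedron, which contains `Γ(𝒳)`; adding `C`
then covers the upper image.

Three facts keep the invariant alive. Strong duality for (P(v)), from separation in the space of
perturbations under a Slater condition, makes every cut valid (`exists_le_dualObjective`,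
`upperImage_inter_subset_cutHalfspace`). Optimal solutions at vertices are weak minimizers, since
otherwise `z` could be shortened or, if `z = 0`, a segment around the vertex would stay in the
polyhedron (`isWeakMinimizer_of_isPrimalOptimal`). The initial truncated polyhedron is compact
(`isCompact_outerZero_inter`). The only property of `γ` needed is that it strictly exceeds `w̄ᵀΓ` on
`𝒳`. -/

open Filter Topology

/-! ### Polyhedra and their extreme points -/

section Convexity

variable {Y : Type*} [NormedAddCommGroup Y] [NormedSpace ℝ Y]

/-- A set cut out by finitely many closed affine halfspaces. -/
def IsPolyhedron (A : Set Y) : Prop :=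
  ∃ S : Set (StrongDual ℝ Y × ℝ), S.Finite ∧ A = {y | ∀ p ∈ S, p.2 ≤ p.1 y}

theorem IsPolyhedron.inter {A B : Set Y} (hA : IsPolyhedron A) (hB : IsPolyhedron B) :
    IsPolyhedron (A ∩ B) := by
  obtain ⟨S, hS, rfl⟩ := hA
  obtain ⟨T, hT, rfl⟩ := hB
  refine ⟨S ∪ T, hS.union hT, ?_⟩
  ext y
  constructor
  · rintro ⟨h1, h2⟩ p (hp | hp)
    exacts [h1 p hp, h2 p hp]
  · exact fun h => ⟨fun p hp => h p (Or.inl hp), fun p hp => h p (Or.inr hp)⟩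

theorem isPolyhedron_ge (f : StrongDual ℝ Y) (a : ℝ) : IsPolyhedron {y | a ≤ f y} :=
  ⟨{(f, a)}, Set.finite_singleton _, by simp⟩

theorem isPolyhedron_le (f : StrongDual ℝ Y) (a : ℝ) : IsPolyhedron {y | f y ≤ a} := by
  simpa using isPolyhedron_ge (-f) (-a)

theorem isPolyhedron_forall_ge {ι : Type*} [Finite ι] (f : ι → StrongDual ℝ Y) (a : ι → ℝ) :
    IsPolyhedron {y | ∀ i, a i ≤ f i y} :=
  ⟨Set.range fun i => (f i, a i), Set.finite_range _, by simp⟩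

theorem IsPolyhedron.isClosed {A : Set Y} (hA : IsPolyhedron A) : IsClosed A := by
  obtain ⟨S, -, rfl⟩ := hA
  simp only [Set.ofPred_forall]
  exact isClosed_biInter fun p _ => isClosed_le continuous_const p.1.continuous

theorem IsPolyhedron.convex {A : Set Y} (hA : IsPolyhedron A) : Convex ℝ A := by
  obtain ⟨S, -, rfl⟩ := hA
  simp only [Set.ofPred_forall]
  exact convex_iInter₂ fun p _ => convex_halfSpace_ge p.1.toLinearMap.isLinear p.2

/-- Around an extreme point of `A` no line stays in `A`. -/
theorem direction_eq_zero_of_mem_extremePoints {A : Set Y} {x d : Y}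
    (hx : x ∈ Set.extremePoints ℝ A) (hd : ∀ᶠ t in 𝓝 (0 : ℝ), x + t • d ∈ A) : d = 0 := by
  obtain ⟨δ, hδ, h⟩ := Metric.eventually_nhds_iff.1 hd
  have hδ2 : |δ / 2| < δ := by rw [abs_of_pos (by positivity)]; linarith
  have h1 : x + (δ / 2) • d ∈ A := h (by rwa [dist_zero_right, Real.norm_eq_abs])
  have h2 : x + (-(δ / 2)) • d ∈ A := h (by rwa [dist_zero_right, norm_neg, Real.norm_eq_abs])
  have h3 := hx.2 h1 h2 ⟨1 / 2, 1 / 2, by norm_num, by norm_num, by norm_num, by module⟩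
  have h4 : (δ / 2) • d = 0 := by simpa using h3
  rcases smul_eq_zero.1 h4 with h5 | h5
  · linarith
  · exact h5

/-- An extreme point is determined by its set of active constraints: if `y` has the same active set
as `x`, then the line through both stays in the polyhedron near `x`. There are only finitely many
possible active sets. -/
theorem IsPolyhedron.finite_extremePoints {A : Set Y} (hA : IsPolyhedron A) :
    (Set.extremePoints ℝ A).Finite := by
  obtain ⟨S, hS, rfl⟩ := hA
  refine Set.Finite.of_finite_image (f := fun x => {p ∈ S | p.1 x = p.2})
    (hS.finite_subsets.subset ?_) ?_
  · rintro _ ⟨x, -, rfl⟩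
    exact Set.sep_subset _ _
  · intro x hx y hy hxy
    have key : y - x = 0 := by
      refine direction_eq_zero_of_mem_extremePoints hx ?_
      simp only [Set.mem_ofPred_eq]
      rw [eventually_all_finite hS]
      intro p hp
      by_cases hpx : p.1 x = p.2
      · have hpy : p ∈ {p ∈ S | p.1 y = p.2} := by
          have h : p ∈ {p ∈ S | p.1 x = p.2} := ⟨hp, hpx⟩
          exact (show {p ∈ S | p.1 x = p.2} = {p ∈ S | p.1 y = p.2} from hxy) ▸ h
        exact Eventually.of_forall fun t => by simp [hpx, hpy.2]
      · have hlt : p.2 < p.1 x := lt_of_le_of_ne (hx.1 p hp) (Ne.symm hpx)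
        have hc : ContinuousAt (fun t : ℝ => p.1 (x + t • (y - x))) 0 := by fun_prop
        filter_upwards [hc.eventually (lt_mem_nhds (a := p.2) (by simpa using hlt))] with t ht
        exact ht.le
    exact (sub_eq_zero.1 key).symm

/-- Krein–Milman; the hull of finitely many points is already closed, so `Q` need not be closed. -/
theorem IsPolyhedron.subset_of_extremePoints_subset {A Q : Set Y} (hA : IsPolyhedron A)
    (hc : IsCompact A) (hQ : Convex ℝ Q) (h : Set.extremePoints ℝ A ⊆ Q) : A ⊆ Q := by
  rw [← closure_convexHull_extremePoints hc hA.convex,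
    (hA.finite_extremePoints.isClosed_convexHull ℝ).closure_eq]
  exact convexHull_min h hQ

theorem nonneg_of_forall_lt_add_mul {A B D : ℝ} (h : ∀ r : ℝ, 0 ≤ r → D < A + r * B) :
    0 ≤ B := by
  by_contra! hB
  have h0 := h 0 le_rfl
  have h1 := h ((A - D) / (-B)) (div_nonneg (by linarith) (by linarith))
  have : (A - D) / (-B) * B = D - A := by
    rw [div_neg, neg_mul, div_mul_cancel₀ _ hB.ne, neg_sub]
  linarith

theorem le_of_forall_pos_lt_add_mul {A B D : ℝ} (h : ∀ r : ℝ, 0 < r → D < A + r * B) :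
    D ≤ A := by
  have hc : Tendsto (fun r : ℝ => A + r * B) (𝓝[>] 0) (𝓝 (A + 0 * B)) :=
    (Continuous.tendsto (by fun_prop) 0).mono_left nhdsWithin_le_nhds
  rw [zero_mul, add_zero] at hc
  exact ge_of_tendsto hc (eventually_nhdsWithin_of_forall fun r hr => (h r hr).le)

end Convexity

/-! ### The ordering cone and the upper image -/

namespace CVOP

variable {n : ℕ} {Y : Type*} [NormedAddCommGroup Y] [NormedSpace ℝ Y] {P : CVOP n Y}

theorem add_mem_C {a b : Y} (ha : a ∈ P.C) (hb : b ∈ P.C) : a + b ∈ P.C :=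
  P.C.toSubmodule.add_mem ha hb

theorem smul_mem_C {a : Y} {r : ℝ} (hr : 0 ≤ r) (ha : a ∈ P.C) : r • a ∈ P.C :=
  P.C.toSubmodule.smul_mem ⟨r, hr⟩ ha

theorem convex_C (P : CVOP n Y) : Convex ℝ (P.C : Set Y) :=
  fun _ hx _ hy _ _ ha hb _ => add_mem_C (smul_mem_C ha hx) (smul_mem_C hb hy)

theorem interior_add_mem {a b : Y} (ha : a ∈ interior (P.C : Set Y)) (hb : b ∈ P.C) :
    a + b ∈ interior (P.C : Set Y) := by
  have h := subset_interior_add_left (Set.add_mem_add ha (show b ∈ (P.C : Set Y) from hb))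
  refine interior_mono ?_ h
  rintro _ ⟨u, hu, v, hv, rfl⟩
  exact add_mem_C hu hv

theorem smul_mem_interior {a : Y} {r : ℝ} (hr : 0 < r) (ha : a ∈ interior (P.C : Set Y)) :
    r • a ∈ interior (P.C : Set Y) := by
  have h : r • interior (P.C : Set Y) ⊆ interior (P.C : Set Y) := by
    refine interior_maximal ?_ (isOpen_interior.smul₀ hr.ne')
    rintro _ ⟨u, hu, rfl⟩
    exact smul_mem_C hr.le (interior_subset hu)
  exact h (Set.smul_mem_smul_set ha)

theorem feas_nonempty (P : CVOP n Y) : P.feas.Nonempty := P.feas_interior.mono interior_subset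

theorem continuousOn_feas (P : CVOP n Y) : ContinuousOn P.Γ P.feas :=
  P.Γ_continuous.mono P.feas_subset

theorem mem_upperImage {y : Y} : y ∈ P.upperImage ↔ ∃ x ∈ P.feas, y - P.Γ x ∈ P.C := by
  constructor
  · rintro ⟨_, ⟨x, hx, rfl⟩, c, hc, rfl⟩
    exact ⟨x, hx, by simpa using hc⟩
  · rintro ⟨x, hx, hc⟩
    exact ⟨P.Γ x, ⟨x, hx, rfl⟩, _, hc, by simp⟩

theorem Γ_mem_upperImage {x : EuclideanSpace ℝ (Fin n)} (hx : x ∈ P.feas) :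
    P.Γ x ∈ P.upperImage :=
  mem_upperImage.2 ⟨x, hx, by simp⟩

theorem isClosed_upperImage (P : CVOP n Y) : IsClosed P.upperImage :=
  P.C.isClosed.add_left_of_isCompact (P.feas_compact.image_of_continuousOn P.continuousOn_feas)

/-- A functional in the dual cone that is not zero is positive on the interior of the cone. -/
theorem pos_of_mem_dualCone {u : StrongDual ℝ Y} (hu : u ∈ P.dualCone) (h0 : u ≠ 0) {e : Y}
    (he : e ∈ interior (P.C : Set Y)) : 0 < u e := by
  by_contra! hle
  refine h0 (ContinuousLinearMap.ext fun d => ?_)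
  have key : ∀ d, 0 ≤ u d := by
    intro d
    have hc : ContinuousAt (fun t : ℝ => e + t • d) 0 := by fun_prop
    have hev : ∀ᶠ t in 𝓝 (0 : ℝ), e + t • d ∈ interior (P.C : Set Y) :=
      hc.eventually (isOpen_interior.mem_nhds (by simpa using he))
    obtain ⟨t, ht, htp⟩ :=
      ((hev.filter_mono nhdsWithin_le_nhds).and (self_mem_nhdsWithin (s := Set.Ioi 0))).exists
    have h1 := hu _ (interior_subset ht)
    simp only [map_add, map_smul, smul_eq_mul] at h1
    have h2 : 0 ≤ t * u d := by linarith
    exact nonneg_of_mul_nonneg_right h2 htp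
  have h1 := key d
  have h2 := key (-d)
  rw [map_neg] at h2
  simp only [zero_apply]
  linarith

/-! ### Generators of the dual cone and the initial outer approximation -/

section Generators

variable {J : ℕ} {w : Fin J → StrongDual ℝ Y}

theorem IsDualGenerators.mem_dualCone (hw : P.IsDualGenerators w) (j : Fin J) :
    w j ∈ P.dualCone := by
  classical
  rw [hw.1]
  refine ⟨Pi.single j 1, fun i => ?_, ?_⟩
  · by_cases h : i = j
    · subst h; simp
    · simp [h]
  · simp [Pi.single_apply]

/-- The functionals describing the polyhedral cone belong to `C⁺`, hence are nonnegative
combinations of the generators. This replaces the bipolar theorem. -/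
theorem IsDualGenerators.mem_C_iff (hw : P.IsDualGenerators w) (hC : P.PolyhedralCone) (y : Y) :
    y ∈ P.C ↔ ∀ j, 0 ≤ w j y := by
  refine ⟨fun hy j => hw.mem_dualCone j y hy, fun h => ?_⟩
  obtain ⟨F, -, hF⟩ := hC
  have hmem : ∀ z, z ∈ P.C ↔ ∀ f ∈ F, 0 ≤ f z := fun z => by
    rw [← SetLike.mem_coe, hF, Set.mem_ofPred_eq]
  rw [hmem]
  intro f hf
  have hfd : f ∈ P.dualCone := fun z hz => (hmem z).1 hz f hf
  rw [hw.1] at hfd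
  obtain ⟨c, hc, rfl⟩ := hfd
  simpa using Finset.sum_nonneg fun j _ => mul_nonneg (hc j) (h j)

theorem IsDualGenerators.nonempty (hw : P.IsDualGenerators w) (hC : P.PolyhedralCone) :
    Nonempty (Fin J) := by
  by_contra hJ
  rw [not_nonempty_iff] at hJ
  exact P.C_ne_univ (Set.eq_univ_of_forall fun y => (hw.mem_C_iff hC y).2 fun j => isEmptyElim j)

theorem IsDualGenerators.ne_zero (hw : P.IsDualGenerators w) (j : Fin J) : w j ≠ 0 := by
  intro h
  simpa [h] using hw.2 j

theorem IsDualGenerators.norm_sum_pos (hw : P.IsDualGenerators w) (hC : P.PolyhedralCone) :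
    0 < ‖∑ j, w j‖ := by
  have := hw.nonempty hC
  obtain ⟨e, he⟩ := P.C_solid
  rw [norm_pos_iff]
  intro h
  have hpos : 0 < ∑ j, w j e := Finset.sum_pos
    (fun j _ => pos_of_mem_dualCone (hw.mem_dualCone j) (hw.ne_zero j) he) Finset.univ_nonempty
  have h2 : (∑ j, w j) e = 0 := by rw [h]; simp
  rw [sum_apply] at h2
  linarith

theorem norm_mul_wbar (hw : P.IsDualGenerators w) (hC : P.PolyhedralCone) (y : Y) :
    ‖∑ j, w j‖ * wbar w y = ∑ j, w j y := by
  have := (hw.norm_sum_pos hC).ne'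
  simp only [wbar, smul_apply, sum_apply, smul_eq_mul]
  field_simp

/-- This is pointedness: a vector killed by all generators lies in `C ∩ -C`. -/
theorem IsDualGenerators.injective (hw : P.IsDualGenerators w) (hC : P.PolyhedralCone) :
    Function.Injective (LinearMap.pi fun j => (w j).toLinearMap) := by
  rw [← LinearMap.ker_eq_bot, LinearMap.ker_eq_bot']
  intro y hy
  have hy' : ∀ j, w j y = 0 := fun j => congrFun hy j
  have : y ∈ (P.C : Set Y) ∩ -(P.C : Set Y) :=
    ⟨(hw.mem_C_iff hC y).2 fun j => (hy' j).ge,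
      (hw.mem_C_iff hC (-y)).2 fun j => by simp [hy' j]⟩
  rw [P.C_pointed] at this
  exact this

theorem isPolyhedron_outerZero_inter (w : Fin J → StrongDual ℝ Y)
    (x : Fin J → EuclideanSpace ℝ (Fin n)) (γ : ℝ) :
    IsPolyhedron (P.outerZero w x ∩ halfspaceS (wbar w) γ) :=
  (isPolyhedron_forall_ge w fun j => w j (P.Γ (x j))).inter (isPolyhedron_le (wbar w) γ)

/-- The coordinates `w j y` embed the space as a closed subspace. On this set the gaps `w j y - a j`
are nonnegative and the bound on `w̄ᵀ y` limits their sum to `K`, so each gap is at most `K` and the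
image lies in a box. -/
theorem isCompact_outerZero_inter [FiniteDimensional ℝ Y] (hw : P.IsDualGenerators w)
    (hC : P.PolyhedralCone) (x : Fin J → EuclideanSpace ℝ (Fin n)) (γ : ℝ) :
    IsCompact (P.outerZero w x ∩ halfspaceS (wbar w) γ) := by
  set a : Fin J → ℝ := fun j => w j (P.Γ (x j)) with ha
  set K : ℝ := ‖∑ j, w j‖ * γ - ∑ j, a j with hK
  have hemb := LinearMap.isClosedEmbedding_of_injective (LinearMap.ker_eq_bot.2 (hw.injective hC))
  have hcomp := hemb.isCompact_preimage (isCompact_Icc (a := a) (b := fun j => a j + K))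
  refine hcomp.of_isClosed_subset (isPolyhedron_outerZero_inter w x γ).isClosed ?_
  rintro y ⟨hy, hyS⟩
  have hsum : ∑ j, (w j y - a j) ≤ K := by
    rw [Finset.sum_sub_distrib, ← norm_mul_wbar hw hC y]
    have := mul_le_mul_of_nonneg_left (show wbar w y ≤ γ from hyS) (norm_nonneg (∑ j, w j))
    linarith
  refine ⟨fun j => hy j, fun j => ?_⟩
  have h1 := Finset.single_le_sum (f := fun j => w j y - a j)
    (fun i _ => sub_nonneg.2 (hy i)) (Finset.mem_univ j)
  change w j y ≤ a j + K
  linarith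

theorem upperImage_subset_outerZero (hw : P.IsDualGenerators w)
    {x : Fin J → EuclideanSpace ℝ (Fin n)} (hx : ∀ j, P.IsWSOptimal (w j) (x j)) :
    P.upperImage ⊆ P.outerZero w x := by
  intro y hy j
  obtain ⟨x', hx', hc⟩ := mem_upperImage.1 hy
  have h1 := (hx j).2 x' hx'
  have h2 := hw.mem_dualCone j _ hc
  rw [map_sub] at h2
  linarith

theorem exists_isWSOptimal (P : CVOP n Y) (u : StrongDual ℝ Y) : ∃ x, P.IsWSOptimal u x := by
  obtain ⟨x, hx, h⟩ := P.feas_compact.exists_isMinOn P.feas_nonempty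
    (u.continuous.comp_continuousOn P.continuousOn_feas)
  exact ⟨x, hx, fun x' hx' => h hx'⟩

theorem isWeakMinimizer_of_isWSOptimal {u : StrongDual ℝ Y} (hu : u ∈ P.dualCone) (h0 : u ≠ 0)
    {x : EuclideanSpace ℝ (Fin n)} (hx : P.IsWSOptimal u x) : P.IsWeakMinimizer x := by
  refine ⟨hx.1, ⟨x, hx.1, rfl⟩, ?_⟩
  rw [Set.eq_empty_iff_forall_notMem]
  rintro _ ⟨⟨_, rfl, c, hc, h⟩, x', hx', rfl⟩
  have h1 := hx.2 x' hx'
  have h2 := pos_of_mem_dualCone hu h0 hc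
  have h3 : P.Γ x - c = P.Γ x' := h
  rw [← h3, map_sub] at h1
  linarith

theorem exists_isAdmissibleGamma (P : CVOP n Y) (w : Fin J → StrongDual ℝ Y)
    (x : Fin J → EuclideanSpace ℝ (Fin n)) : ∃ γ, P.IsAdmissibleGamma w x γ :=
  ⟨_, _, le_rfl, lt_add_one _⟩

/-- The vertex term and the Hausdorff term are nonnegative whatever their size, because `sSup` is
`0` on empty or unbounded sets of reals. The resulting strict inequality serves as the Slater
condition for (P(v)). -/
theorem IsAdmissibleGamma.lt {x : Fin J → EuclideanSpace ℝ (Fin n)} {γ : ℝ}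
    (h : P.IsAdmissibleGamma w x γ) {x' : EuclideanSpace ℝ (Fin n)} (hx' : x' ∈ P.feas) :
    wbar w (P.Γ x') < γ := by
  obtain ⟨β, -, hγ⟩ := h
  have h1 : wbar w (P.Γ x') ≤ sSup ((fun x' => wbar w (P.Γ x')) '' P.feas) :=
    le_csSup (P.feas_compact.bddAbove_image
      ((wbar w).continuous.comp_continuousOn P.continuousOn_feas)) ⟨x', hx', rfl⟩
  have h2 : 0 ≤ sSup ((fun v => max (wbar w v - β) 0) ''
      Set.extremePoints ℝ (P.outerZero w x)) := by
    refine Real.sSup_nonneg ?_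
    rintro _ ⟨v, -, rfl⟩
    exact le_max_right _ _
  have h3 := Metric.hausdorffDist_nonneg (s := P.outerZero w x) (t := P.upperImage)
  linarith

end Generators

/-! ### Duality for the scalarization, cuts and weak minimizers -/

section Scalarization

variable {b : StrongDual ℝ Y} {γ : ℝ}

/-- The feasible values `v + z` are exactly the points of the truncated upper image, which is closed
and nonempty; a nearest point to `v` solves the problem. -/
theorem exists_isPrimalOptimal [FiniteDimensional ℝ Y] (hγ : ∀ x ∈ P.feas, b (P.Γ x) < γ)
    (v : Y) : ∃ x z, P.IsPrimalOptimal b γ v x z := by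
  have hcl : IsClosed (P.upperImage ∩ halfspaceS b γ) :=
    P.isClosed_upperImage.inter (isPolyhedron_le b γ).isClosed
  obtain ⟨x₀, hx₀⟩ := P.feas_nonempty
  have := FiniteDimensional.proper ℝ Y
  obtain ⟨y, ⟨hy, hyS⟩, hmin⟩ := hcl.exists_infDist_eq_dist
    ⟨P.Γ x₀, Γ_mem_upperImage hx₀, (hγ x₀ hx₀).le⟩ v
  obtain ⟨x, hx, hc⟩ := mem_upperImage.1 hy
  refine ⟨x, y - v, ⟨hx, by simpa using hc, by rw [add_sub_cancel]; exact hyS⟩, ?_⟩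
  rintro x' z' ⟨hx', hc', hS'⟩
  have h := Metric.infDist_le_dist_of_mem (x := v)
    (show v + z' ∈ P.upperImage ∩ halfspaceS b γ from ⟨mem_upperImage.2 ⟨x', hx', hc'⟩, hS'⟩)
  rw [hmin, dist_comm, dist_eq_norm] at h
  simpa using h

theorem le_dualObjective_iff {v : Y} {u : StrongDual ℝ Y} {lam p : ℝ} :
    (p : EReal) ≤ P.dualObjective b γ v u lam ↔
      ∀ x ∈ P.feas, ∀ z, p ≤ ‖z‖ + u (P.Γ x - z - v) + lam * (b (v + z) - γ) := by
  simp only [dualObjective, le_iInf_iff, EReal.coe_le_coe_iff]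

theorem PrimalFeasible.dualObjective_le {v z : Y} {x : EuclideanSpace ℝ (Fin n)}
    (h : P.PrimalFeasible b γ v x z) {u : StrongDual ℝ Y} (hu : u ∈ P.dualCone) {lam : ℝ}
    (hl : 0 ≤ lam) : P.dualObjective b γ v u lam ≤ (‖z‖ : ℝ) := by
  refine (iInf₂_le x h.1).trans ((iInf_le _ z).trans ?_)
  rw [EReal.coe_le_coe_iff]
  have h1 := hu _ h.2.1
  have h2 : u (P.Γ x - z - v) = -u (v + z - P.Γ x) := by rw [← map_neg]; congr 1; abel
  have h3 := mul_nonneg hl (sub_nonneg.2 h.2.2)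
  rw [h2]
  linarith

/-- The set of triples of perturbations of the constraints and strict upper bounds for the
objective value of (P(v)). -/
def perturbationSet (P : CVOP n Y) (b : StrongDual ℝ Y) (γ : ℝ) (v : Y) : Set (Y × ℝ × ℝ) :=
  {m | ∃ x ∈ P.feas, ∃ z : Y, m.1 - (P.Γ x - z - v) ∈ interior (P.C : Set Y) ∧
    b (v + z) - γ < m.2.1 ∧ ‖z‖ < m.2.2}

theorem isOpen_perturbationSet (v : Y) : IsOpen (P.perturbationSet b γ v) := by
  have : P.perturbationSet b γ v = ⋃ x ∈ P.feas, ⋃ z : Y,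
      {m : Y × ℝ × ℝ | m.1 - (P.Γ x - z - v) ∈ interior (P.C : Set Y)} ∩
        ({m | b (v + z) - γ < m.2.1} ∩ {m | ‖z‖ < m.2.2}) := by
    ext m
    simp [perturbationSet]
  rw [this]
  refine isOpen_biUnion fun x _ => isOpen_iUnion fun z => ?_
  refine IsOpen.inter (isOpen_interior.preimage (by fun_prop)) (IsOpen.inter ?_ ?_)
  · exact isOpen_lt continuous_const (by fun_prop)
  · exact isOpen_lt continuous_const (by fun_prop)

theorem convex_perturbationSet (v : Y) : Convex ℝ (P.perturbationSet b γ v) := by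
  rintro m₁ ⟨x₁, hx₁, z₁, hc₁, hs₁, ht₁⟩ m₂ ⟨x₂, hx₂, z₂, hc₂, hs₂, ht₂⟩ r s hr hs hrs
  have hs' : s = 1 - r := by linarith
  refine ⟨r • x₁ + s • x₂, P.feas_convex hx₁ hx₂ hr hs hrs, r • z₁ + s • z₂, ?_, ?_, ?_⟩
  · have h1 := P.convex_C.interior hc₁ hc₂ hr hs hrs
    have h2 := P.Γ_convex x₁ (P.feas_subset hx₁) x₂ (P.feas_subset hx₂) r ⟨hr, by linarith⟩
    rw [← hs'] at h2
    convert interior_add_mem h1 h2 using 1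
    have hv : v = r • v + s • v := by rw [← add_smul, hrs, one_smul]
    nth_rewrite 1 [hv]
    simp only [Prod.fst_add, Prod.smul_fst]
    module
  · simp only [Prod.snd_add, Prod.smul_snd, Prod.fst_add, Prod.smul_fst, map_add, map_smul,
      smul_eq_mul] at hs₁ hs₂ ⊢
    have hg : b v - γ = r * (b v - γ) + s * (b v - γ) := by rw [← add_mul, hrs, one_mul]
    have h : r * (b v + b z₁ - γ) + s * (b v + b z₂ - γ) < r * m₁.2.1 + s * m₂.2.1 := by
      rcases hr.eq_or_lt with rfl | hr
      · have : s = 1 := by linarith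
        subst this
        linarith
      · exact add_lt_add_of_lt_of_le (mul_lt_mul_of_pos_left hs₁ hr)
          (mul_le_mul_of_nonneg_left hs₂.le hs)
    linarith
  · simp only [Prod.snd_add, Prod.smul_snd, smul_eq_mul] at ht₁ ht₂ ⊢
    have h0 : ‖r • z₁ + s • z₂‖ ≤ r * ‖z₁‖ + s * ‖z₂‖ := by
      refine (norm_add_le _ _).trans_eq ?_
      rw [norm_smul, norm_smul, Real.norm_of_nonneg hr, Real.norm_of_nonneg hs]
    refine h0.trans_lt ?_
    rcases hr.eq_or_lt with rfl | hr
    · have : s = 1 := by linarith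
      subst this
      linarith
    · exact add_lt_add_of_lt_of_le (mul_lt_mul_of_pos_left ht₁ hr)
        (mul_le_mul_of_nonneg_left ht₂.le hs)

/-- Strong duality between (P(v)) and (D(v)). -/
theorem exists_le_dualObjective (hγ : ∀ x ∈ P.feas, b (P.Γ x) < γ) {v z : Y}
    {x : EuclideanSpace ℝ (Fin n)} (h : P.IsPrimalOptimal b γ v x z) :
    ∃ u ∈ P.dualCone, ∃ lam : ℝ, 0 ≤ lam ∧
      ((‖z‖ : ℝ) : EReal) ≤ P.dualObjective b γ v u lam := by
  -- With zero perturbation, no feasible pair has a value strictly below the optimum.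
  have hnot : ((0 : Y), (0 : ℝ), ‖z‖) ∉ P.perturbationSet b γ v := by
    rintro ⟨x', hx', z', hc, hs, ht⟩
    refine absurd (h.2 x' z' ⟨hx', ?_, ?_⟩) (not_le.2 ht)
    · have := interior_subset hc
      rwa [show (0 : Y) - (P.Γ x' - z' - v) = v + z' - P.Γ x' by abel] at this
    · simp only at hs
      linarith
  obtain ⟨f, hf⟩ := geometric_hahn_banach_open_point (convex_perturbationSet v)
    (isOpen_perturbationSet v) hnot
  -- The components of the separating functional, negated so that the multipliers come out
  -- nonnegative: the perturbations and the bound may grow without limit, which fixes the signs.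
  set u : StrongDual ℝ Y := -(f.comp (ContinuousLinearMap.inl ℝ Y (ℝ × ℝ))) with hu
  set lam : ℝ := -f (0, 1, 0) with hlam
  set mu : ℝ := -f (0, 0, 1) with hmu
  have hfe : ∀ (y : Y) (s t : ℝ), f (y, s, t) = -(u y + s * lam + t * mu) := by
    intro y s t
    have : ((y, s, t) : Y × ℝ × ℝ) = (y, 0, 0) + s • (0, 1, 0) + t • (0, 0, 1) := by simp
    have huy : u y = -f (y, 0, 0) := rfl
    rw [this, map_add, map_add, map_smul, map_smul, huy, hlam, hmu, smul_eq_mul, smul_eq_mul]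
    ring
  have hf' : ∀ x' ∈ P.feas, ∀ (z' c : Y) (s t : ℝ), c ∈ interior (P.C : Set Y) → 0 < s → 0 < t →
      ‖z‖ * mu < u (P.Γ x' - z' - v + c) + (b (v + z') - γ + s) * lam + (‖z'‖ + t) * mu := by
    intro x' hx' z' c s t hc hs ht
    have := hf (P.Γ x' - z' - v + c, b (v + z') - γ + s, ‖z'‖ + t)
      ⟨x', hx', z', by simpa using hc, by simpa using hs, by simpa using ht⟩
    rw [hfe, hfe, map_zero] at this
    linarith
  obtain ⟨e, he⟩ := P.C_solid
  obtain ⟨x₀, hx₀⟩ := P.feas_nonempty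
  have hu0 : u ∈ P.dualCone := by
    intro c hc
    refine nonneg_of_forall_lt_add_mul (D := ‖z‖ * mu) (A := u (P.Γ x₀ - 0 - v + e) +
      (b (v + 0) - γ + 1) * lam + (‖(0 : Y)‖ + 1) * mu) fun r hr => ?_
    have := hf' x₀ hx₀ 0 (e + r • c) 1 1 (interior_add_mem he (smul_mem_C hr hc)) one_pos one_pos
    rw [← add_assoc, map_add u _ (r • c), map_smul, smul_eq_mul] at this
    linarith
  have hlam0 : 0 ≤ lam := by
    refine nonneg_of_forall_lt_add_mul (D := ‖z‖ * mu) (A := u (P.Γ x₀ - 0 - v + e) +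
      (b (v + 0) - γ + 1) * lam + (‖(0 : Y)‖ + 1) * mu) fun r hr => ?_
    have := hf' x₀ hx₀ 0 e (1 + r) 1 he (by positivity) one_pos
    linarith
  have hmu0 : 0 ≤ mu := by
    refine nonneg_of_forall_lt_add_mul (D := ‖z‖ * mu) (A := u (P.Γ x₀ - 0 - v + e) +
      (b (v + 0) - γ + 1) * lam + (‖(0 : Y)‖ + 1) * mu) fun r hr => ?_
    have := hf' x₀ hx₀ 0 e 1 (1 + r) he one_pos (by positivity)
    linarith
  -- Slater's condition: at `v + z' = Γ x₀ + t e` both constraints hold with strict slack. Using up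
  -- exactly this slack makes both perturbations zero, so `mu = 0` would give `0 < 0`.
  have hmu1 : 0 < mu := by
    refine lt_of_le_of_ne hmu0 fun hmu2 => ?_
    have hc : ContinuousAt (fun t : ℝ => b (P.Γ x₀ + t • e)) 0 := by fun_prop
    have hev : ∀ᶠ t in 𝓝 (0 : ℝ), b (P.Γ x₀ + t • e) < γ :=
      hc.eventually (gt_mem_nhds (by simpa using hγ x₀ hx₀))
    obtain ⟨t, ht, htp⟩ :=
      ((hev.filter_mono nhdsWithin_le_nhds).and (self_mem_nhdsWithin (s := Set.Ioi 0))).exists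
    have := hf' x₀ hx₀ (P.Γ x₀ + t • e - v) (t • e) (γ - b (P.Γ x₀ + t • e)) 1
      (smul_mem_interior htp he) (by linarith) one_pos
    rw [← hmu2, show P.Γ x₀ - (P.Γ x₀ + t • e - v) - v + t • e = 0 by abel,
      show v + (P.Γ x₀ + t • e - v) = P.Γ x₀ + t • e by abel, map_zero] at this
    linarith
  refine ⟨mu⁻¹ • u, fun y hy => ?_, mu⁻¹ * lam, by positivity, ?_⟩
  · simpa using mul_nonneg (inv_nonneg.2 hmu0) (hu0 y hy)
  · rw [le_dualObjective_iff]
    intro x' hx' z'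
    -- All three slacks are scaled by `r`, and `r` tends to `0`.
    have h1 : ‖z‖ * mu ≤ u (P.Γ x' - z' - v) + (b (v + z') - γ) * lam + ‖z'‖ * mu := by
      refine le_of_forall_pos_lt_add_mul (B := u e + lam + mu) fun r hr => ?_
      have := hf' x' hx' z' (r • e) r r (smul_mem_interior hr he) hr hr
      rw [map_add u _ (r • e), map_smul, smul_eq_mul] at this
      linarith
    rw [smul_apply, smul_eq_mul, ← mul_le_mul_iff_left₀ hmu1]
    refine h1.trans_eq ?_
    field_simp
    ring

theorem exists_isDualOptimal (hγ : ∀ x ∈ P.feas, b (P.Γ x) < γ) {v z : Y}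
    {x : EuclideanSpace ℝ (Fin n)} (h : P.IsPrimalOptimal b γ v x z) :
    ∃ u lam, P.IsDualOptimal b γ v u lam := by
  obtain ⟨u, hu, lam, hl, hle⟩ := exists_le_dualObjective hγ h
  exact ⟨u, lam, ⟨hu, hl⟩, fun u' hu' lam' hl' => (h.1.dualObjective_le hu' hl').trans hle⟩

/-- The halfspace obtained from optimal solutions of (P(v)) and (D(v)) contains the truncated
upper image. -/
theorem upperImage_inter_subset_cutHalfspace (hγ : ∀ x ∈ P.feas, b (P.Γ x) < γ) {v : Y}
    {s : Sol n Y} (hp : P.IsPrimalOptimal b γ v s.x s.z) (hd : P.IsDualOptimal b γ v s.w s.lam) :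
    P.upperImage ∩ halfspaceS b γ ⊆ s.cutHalfspace b v := by
  obtain ⟨u, hu, lam, hl, hle⟩ := exists_le_dualObjective hγ hp
  have hφ := le_dualObjective_iff.1 (hle.trans (hd.2 u hu lam hl))
  -- Taking `z = s.z` in the dual bound cancels the norms. Adding `w (y - Γ x') ≥ 0` and `λ (γ - b
  -- y) ≥ 0` then gives the cut inequality.
  have hL : ∀ x' ∈ P.feas, 0 ≤ s.w (P.Γ x') - s.w (v + s.z) + s.lam * (b (v + s.z) - γ) := by
    intro x' hx'
    have h1 := hφ x' hx' s.z
    rw [show P.Γ x' - s.z - v = P.Γ x' - (v + s.z) by abel, map_sub] at h1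
    linarith
  have h1 := hL s.x hp.1.1
  have h2 := hd.1.1 _ hp.1.2.1
  rw [map_sub] at h2
  have h3 := mul_nonneg hd.1.2 (sub_nonneg.2 hp.1.2.2)
  rintro y ⟨hy, hyS⟩
  obtain ⟨x', hx', hc⟩ := mem_upperImage.1 hy
  have h4 := hd.1.1 _ hc
  rw [map_sub] at h4
  have h5 := hL x' hx'
  have h6 := mul_nonneg hd.1.2 (sub_nonneg.2 (show b y ≤ γ from hyS))
  simp only [Sol.cutHalfspace, Set.mem_ofPred_eq, sub_apply,
    smul_apply, smul_eq_mul]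
  linarith

/-- Optimal solutions of (P(v)) at vertices of a truncated outer approximation are weak
minimizers. -/
theorem isWeakMinimizer_of_isPrimalOptimal [FiniteDimensional ℝ Y]
    (hq : 2 ≤ Module.finrank ℝ Y) {A : Set Y} (hPA : P.upperImage ∩ halfspaceS b γ ⊆ A)
    (hAS : A ⊆ halfspaceS b γ) {v : Y} (hv : v ∈ Set.extremePoints ℝ A)
    {x : EuclideanSpace ℝ (Fin n)} {z : Y} (h : P.IsPrimalOptimal b γ v x z) :
    P.IsWeakMinimizer x := by
  refine ⟨h.1.1, ⟨x, h.1.1, rfl⟩, ?_⟩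
  rw [Set.eq_empty_iff_forall_notMem]
  rintro _ ⟨⟨_, rfl, c, hc, hxc⟩, x', hx', rfl⟩
  have hxc' : P.Γ x - c = P.Γ x' := hxc
  have hvS : b v ≤ γ := hAS hv.1
  have hint : v + z - P.Γ x' ∈ interior (P.C : Set Y) := by
    rw [← hxc', show v + z - (P.Γ x - c) = c + (v + z - P.Γ x) by abel]
    exact interior_add_mem hc h.1.2.1
  -- If `z = 0`, the vertex `v` is interior to `Γ x' + C`. As the dimension is at least two, some
  -- nonzero `d` satisfies `b d = 0`; moving along `±d` stays in `A`, contradicting extremality.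
  by_cases hz : z = 0
  · subst hz
    rw [add_zero] at hint
    have hker : 0 < Module.finrank ℝ (LinearMap.ker b.toLinearMap) := by
      have h1 := LinearMap.finrank_range_add_finrank_ker b.toLinearMap
      have h2 := Submodule.finrank_le (LinearMap.range b.toLinearMap)
      rw [Module.finrank_self] at h2
      omega
    obtain ⟨⟨d, hd⟩, hd0⟩ := Module.finrank_pos_iff_exists_ne_zero.1 hker
    have hbd : b d = 0 := hd
    refine hd0 (Subtype.ext (direction_eq_zero_of_mem_extremePoints hv ?_))
    have hcont : ContinuousAt (fun t : ℝ => v + t • d - P.Γ x') 0 := by fun_prop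
    filter_upwards [hcont.eventually (isOpen_interior.mem_nhds (by simpa using hint))] with t ht
    exact hPA ⟨mem_upperImage.2 ⟨x', hx', interior_subset ht⟩,
      show b (v + t • d) ≤ γ by simpa [hbd] using hvS⟩
  -- If `z ≠ 0`, the shorter vector `(1 - t) • z` remains feasible together with `x'`: the cone
  -- constraint has room, and `v` and `v + z` both lie in the halfspace.
  · have hcont : ContinuousAt (fun t : ℝ => v + (1 - t) • z - P.Γ x') 0 := by fun_prop
    have hev : ∀ᶠ t in 𝓝 (0 : ℝ), v + (1 - t) • z - P.Γ x' ∈ interior (P.C : Set Y) :=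
      hcont.eventually (isOpen_interior.mem_nhds (by simpa using hint))
    obtain ⟨t, ht, ht0, ht1⟩ := ((hev.filter_mono nhdsWithin_le_nhds).and
      (Ioo_mem_nhdsGT (zero_lt_one (α := ℝ)))).exists
    have hS : b (v + (1 - t) • z) ≤ γ := by
      have h1 := mul_le_mul_of_nonneg_left hvS ht0.le
      have h2 := mul_le_mul_of_nonneg_left h.1.2.2 (sub_nonneg.2 ht1.le)
      rw [map_add] at h2
      rw [map_add, map_smul, smul_eq_mul]
      linarith
    have h1 := h.2 x' _ ⟨hx', interior_subset ht, hS⟩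
    rw [norm_smul, Real.norm_of_nonneg (sub_nonneg.2 ht1.le)] at h1
    have h2 := mul_pos ht0 (norm_pos_iff.2 hz)
    linarith

/-- A compact polyhedral outer approximation of the truncated upper image whose vertices are
within distance `ε` of the upper image yields a finite approximation of the upper image. -/
theorem upperImage_subset_of_extremePoints (hγ : ∀ x ∈ P.feas, b (P.Γ x) < γ) {A : Set Y}
    (hA : IsPolyhedron A) (hAc : IsCompact A) (hPA : P.upperImage ∩ halfspaceS b γ ⊆ A)
    {Xbar : Set (EuclideanSpace ℝ (Fin n))} {ε : ℝ}
    (hX : ∀ v ∈ Set.extremePoints ℝ A, ∃ x ∈ Xbar, ∃ z : Y, v + z - P.Γ x ∈ P.C ∧ ‖z‖ ≤ ε) :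
    P.upperImage ⊆ (convexHull ℝ (P.Γ '' Xbar) + (P.C : Set Y)) + Metric.closedBall (0 : Y) ε := by
  have hAQ := hA.subset_of_extremePoints_subset hAc
    (((convex_convexHull ℝ (P.Γ '' Xbar)).add P.convex_C).add (convex_closedBall (0 : Y) ε)) <| by
      intro v hv
      obtain ⟨x, hx, z, hc, hz⟩ := hX v hv
      exact ⟨P.Γ x + (v + z - P.Γ x),
        ⟨P.Γ x, subset_convexHull ℝ _ ⟨x, hx, rfl⟩, _, hc, rfl⟩, -z, by simpa using hz, by
          change P.Γ x + (v + z - P.Γ x) + -z = v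
          abel⟩
  -- Only `Γ x` is known to lie in the truncation; the remainder `y - Γ x` is absorbed by the cone.
  intro y hy
  obtain ⟨x, hx, hc⟩ := mem_upperImage.1 hy
  obtain ⟨_, ⟨q, hq, c, hc', rfl⟩, z, hz, hqz⟩ :=
    hAQ (hPA ⟨Γ_mem_upperImage hx, (hγ x hx).le⟩)
  refine ⟨q + (c + (y - P.Γ x)), ⟨q, hq, _, add_mem_C hc' hc, rfl⟩, z, hz, ?_⟩
  have h : q + c + z = P.Γ x := hqz
  change q + (c + (y - P.Γ x)) + z = y
  rw [← h]
  abel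

end Scalarization

/-! ### Invariants and progress of the algorithm -/

section Algorithm

variable {J : ℕ} {w : Fin J → StrongDual ℝ Y} {ε : ℝ}

/-- The stored solutions for `v` are optimal for (P(v)) and (D(v)). -/
def Memory.Solved (P : CVOP n Y) (w : Fin J → StrongDual ℝ Y) (m : Memory n Y) (v : Y) : Prop :=
  P.IsPrimalOptimal (wbar w) m.γ v (m.sol v).x (m.sol v).z ∧
    P.IsDualOptimal (wbar w) m.γ v (m.sol v).w (m.sol v).lam

/-- The properties of the memory that every step of the algorithm preserves. -/
structure Memory.Valid (P : CVOP n Y) (w : Fin J → StrongDual ℝ Y) (ε : ℝ) (m : Memory n Y) :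
    Prop where
  lt_γ : ∀ x ∈ P.feas, wbar w (P.Γ x) < m.γ
  isPolyhedron : IsPolyhedron m.Pout
  isCompact : IsCompact m.Pout
  subset_halfspace : m.Pout ⊆ halfspaceS (wbar w) m.γ
  upperImage_subset : P.upperImage ∩ halfspaceS (wbar w) m.γ ⊆ m.Pout
  nonempty : m.Xbar.Nonempty
  finite : m.Xbar.Finite
  isWeakMinimizer : ∀ x ∈ m.Xbar, P.IsWeakMinimizer x
  known : ∀ v ∈ m.known, m.Solved P w v ∧ ‖(m.sol v).z‖ ≤ ε ∧ (m.sol v).x ∈ m.Xbar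
  known2 : ∀ v ∈ m.known2, m.Solved P w v ∧ ε < ‖(m.sol v).z‖

theorem Memory.Valid.extremePoints_nonempty {m : Memory n Y} (h : m.Valid P w ε) :
    (Set.extremePoints ℝ m.Pout).Nonempty := by
  obtain ⟨x, hx⟩ := P.feas_nonempty
  exact h.isCompact.extremePoints_nonempty
    ⟨P.Γ x, h.upperImage_subset ⟨Γ_mem_upperImage hx, (h.lt_γ x hx).le⟩⟩

theorem Memory.Valid.exists_isFarthest {m : Memory n Y} (h : m.Valid P w ε) :
    ∃ v, m.IsFarthest v := by
  obtain ⟨v, hv, hmax⟩ := Set.exists_max_image (Set.extremePoints ℝ m.Pout)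
    (fun v => ‖(m.sol v).z‖) h.isPolyhedron.finite_extremePoints h.extremePoints_nonempty
  exact ⟨v, hv, hmax⟩

theorem Memory.store_sol_self (m : Memory n Y) (v : Y) (s : Sol n Y) :
    (m.store v s).sol v = s := by
  simp [Memory.store]

theorem Memory.store_sol_of_ne (m : Memory n Y) {v u : Y} (s : Sol n Y) (h : u ≠ v) :
    (m.store v s).sol u = m.sol u := by
  simp [Memory.store, h]

/-- An unmarked vertex carries no claim, so overwriting its table entry is harmless whatever `s` is.
-/
theorem Memory.Valid.store {m : Memory n Y} (h : m.Valid P w ε) {v : Y} (s : Sol n Y)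
    (hv : v ∉ m.known) (hv2 : v ∉ m.known2) : (m.store v s).Valid P w ε where
  lt_γ := h.lt_γ
  isPolyhedron := h.isPolyhedron
  isCompact := h.isCompact
  subset_halfspace := h.subset_halfspace
  upperImage_subset := h.upperImage_subset
  nonempty := h.nonempty
  finite := h.finite
  isWeakMinimizer := h.isWeakMinimizer
  known := by
    intro u hu
    have hne : u ≠ v := fun e => hv (e ▸ hu)
    rw [Memory.Solved, m.store_sol_of_ne s hne]
    exact h.known u hu
  known2 := by
    intro u hu
    have hne : u ≠ v := fun e => hv2 (e ▸ hu)
    rw [Memory.Solved, m.store_sol_of_ne s hne]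
    exact h.known2 u hu

theorem Memory.record_Pout (m : Memory n Y) (ε : ℝ) (v : Y) : (m.record ε v).Pout = m.Pout := by
  unfold Memory.record; split_ifs <;> rfl

theorem Memory.Valid.record [FiniteDimensional ℝ Y] (hq : 2 ≤ Module.finrank ℝ Y)
    {m : Memory n Y} (h : m.Valid P w ε) {v : Y} (hv : v ∈ Set.extremePoints ℝ m.Pout)
    (hs : m.Solved P w v) : (m.record ε v).Valid P w ε := by
  unfold Memory.record
  split_ifs with hz
  · exact
      { h with
        nonempty := h.nonempty.mono Set.subset_union_left
        finite := h.finite.union (Set.finite_singleton _)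
        isWeakMinimizer := by
          rintro x (hx | rfl)
          · exact h.isWeakMinimizer x hx
          · exact isWeakMinimizer_of_isPrimalOptimal hq h.upperImage_subset h.subset_halfspace
              hv hs.1
        known := by
          rintro u (hu | rfl)
          · obtain ⟨h1, h2, h3⟩ := h.known u hu
            exact ⟨h1, h2, Or.inl h3⟩
          · exact ⟨hs, hz, Or.inr rfl⟩ }
  · exact
      { h with
        known2 := by
          rintro u (hu | rfl)
          · exact h.known2 u hu
          · exact ⟨hs, not_le.1 hz⟩ }

theorem Memory.Valid.cut {m : Memory n Y} (h : m.Valid P w ε) {v : Y} (hs : m.Solved P w v) :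
    Memory.Valid P w ε
      { m with k := m.k + 1, Pout := m.Pout ∩ (m.sol v).cutHalfspace (wbar w) v } :=
  have hpoly : IsPolyhedron ((m.sol v).cutHalfspace (wbar w) v) := isPolyhedron_ge _ _
  { h with
    isPolyhedron := h.isPolyhedron.inter hpoly
    isCompact := h.isCompact.inter_right hpoly.isClosed
    subset_halfspace := Set.inter_subset_left.trans h.subset_halfspace
    upperImage_subset := Set.subset_inter h.upperImage_subset
      (upperImage_inter_subset_cutHalfspace h.lt_γ hs.1 hs.2) }

/-- In the for loop the unvisited vertices are vertices that are not yet known, and all other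
vertices have been treated. -/
def Memory.Pending (m : Memory n Y) (l : List Y) : Prop :=
  l.Nodup ∧ (∀ v ∈ l, v ∈ Set.extremePoints ℝ m.Pout ∧ v ∉ m.known) ∧
    ∀ v ∈ Set.extremePoints ℝ m.Pout, v ∈ l ∨ v ∈ m.known ∨ v ∈ m.known2

theorem Memory.Pending.record {m : Memory n Y} {v : Y} {l : List Y} (h : m.Pending (v :: l)) :
    (m.record ε v).Pending l := by
  obtain ⟨hnd, hl, hall⟩ := h
  rw [List.nodup_cons] at hnd
  refine ⟨hnd.2, fun u hu => ?_, fun u hu => ?_⟩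
  -- The absence of duplicates keeps the remaining vertices unknown after `v` is marked.
  · have hne : u ≠ v := fun e => hnd.1 (e ▸ hu)
    have h1 := hl u (List.mem_cons_of_mem v hu)
    unfold Memory.record
    split_ifs
    · exact ⟨h1.1, fun h => h.elim h1.2 hne⟩
    · exact h1
  · rw [Memory.record_Pout] at hu
    have h1 := hall u hu
    rw [List.mem_cons] at h1
    unfold Memory.record
    split_ifs
    · rcases h1 with (rfl | h1) | h1 | h1
      exacts [Or.inr (Or.inl (Or.inr rfl)), Or.inl h1, Or.inr (Or.inl (Or.inl h1)),
        Or.inr (Or.inr h1)]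
    · rcases h1 with (rfl | h1) | h1 | h1
      exacts [Or.inr (Or.inr (Or.inr rfl)), Or.inl h1, Or.inr (Or.inl h1),
        Or.inr (Or.inr (Or.inl h1))]

/-- The invariant of the algorithm. -/
def Config.Valid (P : CVOP n Y) (w : Fin J → StrongDual ℝ Y) (ε : ℝ) : Config n Y → Prop
  | .start => True
  | .loopHead m => m.Valid P w ε
  | .forLoop m l => m.Valid P w ε ∧ m.Pending l
  | .halted m => m.Valid P w ε ∧ ∀ v ∈ Set.extremePoints ℝ m.Pout, v ∈ m.known

theorem Step.valid [FiniteDimensional ℝ Y] (hq : 2 ≤ Module.finrank ℝ Y) (hC : P.PolyhedralCone)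
    (hw : P.IsDualGenerators w) {c c' : Config n Y} (hs : P.Step w ε c c')
    (hc : c.Valid P w ε) : c'.Valid P w ε := by
  cases hs with
  | init x γ sol₀ hx hγ =>
    have := hw.nonempty hC
    exact
      { lt_γ := fun x' hx' => hγ.lt hx'
        isPolyhedron := isPolyhedron_outerZero_inter w x γ
        isCompact := isCompact_outerZero_inter hw hC x γ
        subset_halfspace := Set.inter_subset_right
        upperImage_subset := Set.inter_subset_inter_left _ (upperImage_subset_outerZero hw hx)
        nonempty := Set.range_nonempty x
        finite := Set.finite_range x
        isWeakMinimizer := by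
          rintro _ ⟨j, rfl⟩
          exact isWeakMinimizer_of_isWSOptimal (hw.mem_dualCone j) (hw.ne_zero j) (hx j)
        known := fun v hv => absurd hv (Set.notMem_empty v)
        known2 := fun v hv => absurd hv (Set.notMem_empty v) }
  | enter m l hl hmem =>
    refine ⟨hc, hl, fun v hv => (hmem v).1 hv, fun v hv => ?_⟩
    by_cases hk : v ∈ m.known
    · exact Or.inr (Or.inl hk)
    · exact Or.inl ((hmem v).2 ⟨hv, hk⟩)
  | solve m v l s hv hprimal hdual =>
    obtain ⟨hm, hp⟩ := hc
    obtain ⟨hext, hk⟩ := hp.2.1 v List.mem_cons_self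
    have hp' : (m.store v s).Pending (v :: l) := hp
    refine ⟨(hm.store s hk hv).record hq hext ?_, hp'.record⟩
    rw [Memory.Solved, m.store_sol_self]
    exact ⟨hprimal, hdual⟩
  | reuse m v l hv =>
    obtain ⟨hm, hp⟩ := hc
    exact ⟨hm.record hq (hp.2.1 v List.mem_cons_self).1 (hm.known2 v hv).1, hp.record⟩
  | cut m v hv hz =>
    obtain ⟨hm, hp⟩ := hc
    -- The list is empty, so the chosen vertex is marked and its stored solutions are optimal.
    rcases hp.2.2 v hv.1 with h | h | h
    · exact absurd h List.not_mem_nil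
    · exact hm.cut (hm.known v h).1
    · exact hm.cut (hm.known2 v h).1
  | halt m v hv hz =>
    obtain ⟨hm, hp⟩ := hc
    refine ⟨hm, fun u hu => ?_⟩
    rcases hp.2.2 u hu with h | h | h
    · exact absurd h List.not_mem_nil
    · exact h
    -- A vertex in `known2` would exceed `ε`, while the farthest vertex does not.
    · exact absurd ((hv.2 u hu).trans hz) (not_le.2 (hm.known2 u h).2)

theorem Reachable.valid [FiniteDimensional ℝ Y] (hq : 2 ≤ Module.finrank ℝ Y)
    (hC : P.PolyhedralCone) (hw : P.IsDualGenerators w) {c : Config n Y}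
    (h : P.Reachable w ε c) : c.Valid P w ε := by
  induction h with
  | refl => trivial
  | tail _ hs ih => exact hs.valid hq hC hw ih

/-- The algorithm never gets stuck. -/
theorem Config.Valid.exists_step [FiniteDimensional ℝ Y] {c : Config n Y}
    (hc : c.Valid P w ε) : (∃ m, c = .halted m) ∨ ∃ c', P.Step w ε c c' := by
  cases c with
  | start =>
    choose x hx using fun j => P.exists_isWSOptimal (w j)
    obtain ⟨γ, hγ⟩ := P.exists_isAdmissibleGamma w x
    exact Or.inr ⟨_, .init x γ (fun _ => ⟨0, 0, 0, 0⟩) hx hγ⟩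
  | loopHead m =>
    have hm : m.Valid P w ε := hc
    have hfin := hm.isPolyhedron.finite_extremePoints.subset
      (Set.sdiff_subset (t := m.known))
    exact Or.inr ⟨_, .enter m hfin.toFinset.toList (Finset.nodup_toList _) fun v => by simp⟩
  | forLoop m l =>
    obtain ⟨hm, hp⟩ := hc
    refine Or.inr ?_
    cases l with
    | nil =>
      obtain ⟨v, hv⟩ := hm.exists_isFarthest
      rcases le_or_gt ‖(m.sol v).z‖ ε with hz | hz
      exacts [⟨_, .halt m v hv hz⟩, ⟨_, .cut m v hv hz⟩]
    | cons v l =>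
      by_cases hv : v ∈ m.known2
      · exact ⟨_, .reuse m v l hv⟩
      · obtain ⟨x, z, hxz⟩ := exists_isPrimalOptimal hm.lt_γ v
        obtain ⟨u, lam, hu⟩ := exists_isDualOptimal hm.lt_γ hxz
        exact ⟨_, .solve m v l ⟨x, z, u, lam⟩ hv hxz hu⟩
  | halted m => exact Or.inl ⟨m, rfl⟩

end Algorithm

end CVOP

theorem mainTheorem4 {n : ℕ} {Y : Type*} [NormedAddCommGroup Y] [NormedSpace ℝ Y]
    [FiniteDimensional ℝ Y] (hq : 2 ≤ Module.finrank ℝ Y)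
    (P : CVOP n Y) (hC : P.PolyhedralCone)
    {J : ℕ} (w : Fin J → StrongDual ℝ Y) (hw : P.IsDualGenerators w)
    (ε : ℝ) (hε : 0 < ε) :
    (∀ c, P.Reachable w ε c →
      (∃ m, c = CVOP.Config.halted m) ∨ ∃ c', P.Step w ε c c') ∧
    (∀ m, P.Reachable w ε (CVOP.Config.halted m) →
      P.IsFiniteWeakSolution ε m.Xbar ∧
      P.upperImage ∩ CVOP.halfspaceS (CVOP.wbar w) m.γ ⊆ m.Pout) := by
  refine ⟨fun c hc => (hc.valid hq hC hw).exists_step, fun m hm => ?_⟩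
  obtain ⟨hv, hext⟩ := hm.valid hq hC hw
  refine ⟨⟨hv.nonempty, hv.finite, hv.isWeakMinimizer, ?_⟩, hv.upperImage_subset⟩
  refine CVOP.upperImage_subset_of_extremePoints hv.lt_γ hv.isPolyhedron hv.isCompact
    hv.upperImage_subset fun v hvext => ?_
  obtain ⟨hs, hz, hx⟩ := hv.known v (hext v hvext)
  exact ⟨_, hx, _, hs.1.1.2.1, hz⟩
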